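/- Let $R$ be an associative ring with $1$; modules are unitary left $R$-modules, viewed as first-order structures in the language with symbols $0,+,-$ and one unary function symbol for each $r\in R$. A unary pp formula is a formula $\varphi(x)$ of the form $\exists y_1\cdots y_k\,(A\bar y=\mathbf b\,x)$ with $A$ an $m\times k$ matrix and $\mathbf b$ an $m\times 1$ column over $R$; it defines a subgroup $\varphi(M)$ of every module $M$, and it is called high if $\varphi(E)=E$ for every injective module $E$. The first Ulm submodule $\mathfrak u(M)$ of a module $M$ is the intersection of the subgroups $\varphi(M)$ over all high formulas $\varphi$. The Ulm sequence of $M$ is defined by $\mathfrak u^0(M)=M$, $\mathfrak u^{\alpha+1}(M)=\mathfrak u(\mathfrak u^\alpha(M))$ and $\mathfrak u^\delta(M)=\bigcap_{\alpha<\delta}\mathfrak u^\alpha(M)$ for limit ordinals $\delta$, and the Ulm length of $M$ is the smallest ordinal $\tau$ with $\mathfrak u^{\tau+1}(M)=\mathfrak u^\tau(M)$. Corollary. Every module $M$ is elementarily equivalent to a module $N$ of Ulm length at most $1$; in fact, $N$ can be chosen so that $M$ is (isomorphic to) an elementary submodule of $N$. -/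

import Mathlib

open FirstOrder

universe u v w

/-! ### The first-order language of left modules over a ring -/

/-- Function symbols of the language of left `R`-modules: `0`, `-`, `+`, and one unary function
symbol for every scalar `r : R`. -/
inductive ModuleFunc (R : Type u) : ℕ → Type u
  | zero : ModuleFunc R 0
  | neg : ModuleFunc R 1
  | add : ModuleFunc R 2
  | smul (r : R) : ModuleFunc R 1

/-- The language of left `R`-modules (there are no relation symbols besides equality). -/
def moduleLanguage (R : Type u) : FirstOrder.Language.{u, 0} where
  Functions := ModuleFunc R
  Relations := fun _ => Empty

/-- Every left `R`-module, as a first-order structure for the language of left `R`-modules. -/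
instance moduleStructure (R : Type u) [Ring R] (M : Type v) [AddCommGroup M] [Module R M] :
    (moduleLanguage R).Structure M where
  funMap := fun {_} f =>
    match f with
    | ModuleFunc.zero => fun _ => 0
    | ModuleFunc.neg => fun x => -x 0
    | ModuleFunc.add => fun x => x 0 + x 1
    | ModuleFunc.smul r => fun x => r • x 0
  RelMap := fun {_} r => Empty.elim r

/-- `S` is an elementary submodule of `N`: the inclusion of the submodule `S`, with its own module
structure, into `N` is an elementary embedding. -/
def Submodule.IsElementary {R : Type u} [Ring R] {N : Type v} [AddCommGroup N] [Module R N]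
    (S : Submodule R N) : Prop :=
  ∃ f : S ↪ₑ[moduleLanguage R] N, ∀ x : S, f x = (x : N)

/-! ### Unary positive primitive formulas and high formulas -/

/-- A unary pp formula `∃ y₁ … yₖ, A y = b x` in the language of left `R`-modules, where `A` is an
`m × k` matrix and `b` an `m × 1` column over `R`. -/
structure UnaryPP (R : Type u) where
  m : ℕ
  k : ℕ
  A : Matrix (Fin m) (Fin k) R
  b : Fin m → R

namespace UnaryPP

variable {R : Type u} [Ring R]

/-- The subgroup `φ(M)` of `M` that is defined by the unary pp formula `φ`. -/
def eval (φ : UnaryPP R) (M : Type v) [AddCommGroup M] [Module R M] : AddSubgroup M where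
  carrier := {x | ∃ y : Fin φ.k → M, ∀ i, ∑ j, φ.A i j • y j = φ.b i • x}
  zero_mem' := ⟨0, fun i => by simp⟩
  add_mem' := by
    rintro x x' ⟨y, hy⟩ ⟨y', hy'⟩
    exact ⟨y + y', fun i => by simp [smul_add, Finset.sum_add_distrib, hy i, hy' i]⟩
  neg_mem' := by
    rintro x ⟨y, hy⟩
    exact ⟨-y, fun i => by simp [hy i]⟩

theorem mem_eval {φ : UnaryPP R} {M : Type v} [AddCommGroup M] [Module R M] {x : M} :
    x ∈ φ.eval M ↔ ∃ y : Fin φ.k → M, ∀ i, ∑ j, φ.A i j • y j = φ.b i • x := Iff.rfl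

/-- `φ` is high: `φ(N) = N` for every injective left `R`-module `N`. (The injective hull of `R`, for
which it suffices to test this, lives in the universe of `R`.) -/
def IsHigh (φ : UnaryPP R) : Prop :=
  ∀ (N : Type u) [AddCommGroup N] [Module R N], Module.Injective R N → φ.eval N = ⊤

/-- The formula `φ(r x)`. -/
def preimage (r : R) (φ : UnaryPP R) : UnaryPP R where
  m := φ.m
  k := φ.k
  A := φ.A
  b := fun i => φ.b i * r

theorem mem_preimage_eval {r : R} {φ : UnaryPP R} {M : Type v} [AddCommGroup M] [Module R M]
    {x : M} : x ∈ (φ.preimage r).eval M ↔ r • x ∈ φ.eval M := by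
  simp [mem_eval, preimage, mul_smul]

theorem IsHigh.preimage {φ : UnaryPP R} (h : φ.IsHigh) (r : R) : (φ.preimage r).IsHigh := by
  intro N _ _ hN
  ext x
  simp [mem_preimage_eval, h N hN]

end UnaryPP

/-! ### Ulm submodules, the Ulm sequence and the Ulm length -/

section Ulm

variable (R : Type u) [Ring R] (M : Type v) [AddCommGroup M] [Module R M]

/-- The first Ulm submodule of `M`: the intersection of all subgroups of `M` that are defined by
high formulas. -/
def ulm : Submodule R M where
  carrier := {x | ∀ φ : UnaryPP R, φ.IsHigh → x ∈ φ.eval M}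
  zero_mem' := fun φ _ => zero_mem (φ.eval M)
  add_mem' := fun hx hy φ h => add_mem (hx φ h) (hy φ h)
  smul_mem' := fun r _ hx φ h => UnaryPP.mem_preimage_eval.1 (hx (φ.preimage r) (h.preimage r))

/-- The Ulm sequence of `M`, as a sequence of submodules of `M`: `u⁰(M) = M`,
`u^(α+1)(M) = u(u^α(M))`, and `u^δ(M) = ⋂_{α < δ} u^α(M)` for limit ordinals `δ`. -/
noncomputable def ulmSeq (α : Ordinal.{w}) : Submodule R M :=
  Ordinal.limitRecOn α ⊤ (fun _ U => (ulm R U).map U.subtype)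
    (fun δ _ U => ⨅ (β : Ordinal.{w}) (h : β < δ), U β h)

/-- The Ulm length of `M`: the smallest ordinal `τ` such that `u^(τ+1)(M) = u^τ(M)`. -/
noncomputable def ulmLength : Ordinal.{v} :=
  sInf {τ : Ordinal.{v} | ulmSeq R M (τ + 1) = ulmSeq R M τ}

theorem ulmSeq_zero : ulmSeq R M (0 : Ordinal.{w}) = ⊤ :=
  Ordinal.limitRecOn_zero _ _ _

theorem ulmSeq_add_one (α : Ordinal.{w}) :
    ulmSeq R M (α + 1) = (ulm R (ulmSeq R M α)).map (ulmSeq R M α).subtype :=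
  Ordinal.limitRecOn_add_one _ _ _ _

theorem ulmSeq_limit (δ : Ordinal.{w}) (hδ : Order.IsSuccLimit δ) :
    ulmSeq R M δ = ⨅ (β : Ordinal.{w}) (_ : β < δ), ulmSeq R M β :=
  Ordinal.limitRecOn_limit _ _ _ _ hδ

theorem ulmSeq_antitone : Antitone (ulmSeq.{u, v, w} R M) := by
  intro α β h
  induction β using Ordinal.limitRecOn with
  | zero => rw [nonpos_iff_eq_zero.1 h]
  | add_one β ih =>
    rcases h.lt_or_eq with h | rfl
    · rw [ulmSeq_add_one]
      exact (Submodule.map_subtype_le _ _).trans (ih (Order.lt_add_one_iff.1 h))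
    · exact le_rfl
  | limit δ hδ _ =>
    rcases h.lt_or_eq with h | rfl
    · rw [ulmSeq_limit R M δ hδ]
      exact iInf₂_le α h
    · exact le_rfl

/-- The Ulm sequence becomes stationary, so that the Ulm length is well defined. -/
theorem ulmSeq_ulmLength : ulmSeq R M (ulmLength R M + 1) = ulmSeq R M (ulmLength R M) := by
  refine csInf_mem (s := {τ : Ordinal.{v} | ulmSeq R M (τ + 1) = ulmSeq R M τ}) ?_
  by_contra hne
  refine not_injective_of_ordinal (ulmSeq.{u, v, v} R M) (StrictAnti.injective ?_)
  intro α β h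
  refine lt_of_le_of_lt (ulmSeq_antitone R M (Order.add_one_le_of_lt h)) ?_
  refine lt_of_le_of_ne (ulmSeq_antitone R M (Order.le_succ α)) ?_
  exact fun e => hne ⟨α, e⟩

end Ulm

/-!
High formulas are closed under requiring the witnesses of a high formula to satisfy finitely many
further high formulas. Hence an element `x` of `u(M)` has, for every high `φ` and every finite set
`F` of high formulas, witnesses for `φ` that satisfy all formulas in `F`. In an ultrapower of `M`
along an ultrafilter on these finite sets that contains all upward cones, the witnesses for the
various `F` combine to witnesses that satisfy every high formula. So the diagonal map, which is
elementary, sends `u(M)` into the second Ulm submodule of the ultrapower.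

Iterating the construction `ω` times gives an elementary chain, with union `N`. An element of `u(N)`
comes from some stage `G n`, and from `u(G n)` because elementary maps reflect pp formulas. It
therefore lies in `u²(G (n + 1))`, and so in `u²(N)`.
-/

/-! ### Positive primitive formulas -/

theorem sum_blockDiagonal'_smul {R M : Type*} [Semiring R] [AddCommMonoid M] [Module R M]
    {ι : Type*} [Fintype ι] [DecidableEq ι] {μ κ : ι → Type*} [∀ i, Fintype (κ i)]
    (A : ∀ i, Matrix (μ i) (κ i) R) (z : (Σ i, κ i) → M) (i : ι) (a : μ i) :
    ∑ q, Matrix.blockDiagonal' A ⟨i, a⟩ q • z q = ∑ l, A i a l • z ⟨i, l⟩ := by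
  rw [Fintype.sum_sigma, Fintype.sum_eq_single i]
  · simp only [Matrix.blockDiagonal'_apply_eq]
  · intro j hj
    simp only [Matrix.blockDiagonal'_apply_ne A a _ hj.symm, zero_smul, Finset.sum_const_zero]

namespace UnaryPP

variable {R : Type u} [Ring R]

/-- The unary pp formula `∃ y, A y = b x` of a linear system whose rows and columns are indexed by
arbitrary finite types, which are enumerated in order to fit the encoding by `Fin`. -/
noncomputable def ofFintype {μ κ : Type*} [Fintype μ] [Fintype κ] (A : Matrix μ κ R) (b : μ → R) :
    UnaryPP R where
  m := Fintype.card μ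
  k := Fintype.card κ
  A := A.submatrix (Fintype.equivFin μ).symm (Fintype.equivFin κ).symm
  b := b ∘ (Fintype.equivFin μ).symm

/-- The formula `∃ y, A y = b x ∧ ⋀ i, ψ i (y (c i))`, where `φ` is `∃ y, A y = b x`: the witnesses
of `φ` are constrained by further pp formulas. -/
noncomputable def constrain (φ : UnaryPP R) {ι : Type*} [Fintype ι] [DecidableEq ι]
    (c : ι → Fin φ.k) (ψ : ι → UnaryPP R) : UnaryPP R :=
  ofFintype
    (Matrix.fromBlocks φ.A 0
      (.of fun p : Σ i, Fin (ψ i).m => Pi.single (c p.1) (-(ψ p.1).b p.2))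
      (Matrix.blockDiagonal' fun i => (ψ i).A))
    (Sum.elim φ.b 0)

variable {M : Type v} [AddCommGroup M] [Module R M]

theorem mem_ofFintype_eval {μ κ : Type*} [Fintype μ] [Fintype κ] {A : Matrix μ κ R} {b : μ → R}
    {x : M} : x ∈ (ofFintype A b).eval M ↔ ∃ y : κ → M, ∀ i, ∑ j, A i j • y j = b i • x := by
  refine ((Fintype.equivFin κ).symm.arrowCongr (Equiv.refl M)).exists_congr fun y =>
    (Fintype.equivFin μ).symm.forall_congr fun i => ?_
  rw [← (Fintype.equivFin κ).symm.sum_comp]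
  simp only [Equiv.arrowCongr_apply, Equiv.symm_symm, Equiv.coe_refl, Function.comp_apply, id_eq,
    Equiv.apply_symm_apply]
  rfl

theorem mem_constrain_eval {φ : UnaryPP R} {ι : Type*} [Fintype ι] [DecidableEq ι]
    {c : ι → Fin φ.k} {ψ : ι → UnaryPP R} {x : M} :
    x ∈ (φ.constrain c ψ).eval M ↔ ∃ y : Fin φ.k → M,
      (∀ i, ∑ j, φ.A i j • y j = φ.b i • x) ∧ ∀ i, y (c i) ∈ (ψ i).eval M := by
  have block_row (y : Fin φ.k → M) (z : (Σ i, Fin (ψ i).k) → M) (i : ι) (a : Fin (ψ i).m) :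
      ∑ j, (Pi.single (c i) (-(ψ i).b a) : Fin φ.k → R) j • y j +
          ∑ q, Matrix.blockDiagonal' (fun i => (ψ i).A) ⟨i, a⟩ q • z q = 0 ↔
        ∑ l, (ψ i).A a l • z ⟨i, l⟩ = (ψ i).b a • y (c i) := by
    have single_row : ∑ j, (Pi.single (c i) (-(ψ i).b a) : Fin φ.k → R) j • y j =
        -((ψ i).b a • y (c i)) := by
      simp [Pi.single_apply, ite_smul]
    rw [single_row, sum_blockDiagonal'_smul, neg_add_eq_zero, eq_comm]
  rw [constrain, mem_ofFintype_eval]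
  constructor
  · rintro ⟨y, hy⟩
    refine ⟨y ∘ Sum.inl, fun i => by simpa using hy (Sum.inl i), fun i =>
      ⟨fun l => y (Sum.inr ⟨i, l⟩), fun a => ?_⟩⟩
    exact (block_row _ (y ∘ Sum.inr) i a).1 (by simpa using hy (Sum.inr ⟨i, a⟩))
  · rintro ⟨y, hy, hψ⟩
    choose z hz using hψ
    refine ⟨Sum.elim y fun q => z q.1 q.2, Sum.rec (fun i => by simpa using hy i) ?_⟩
    rintro ⟨i, a⟩
    simpa using (block_row y (fun q => z q.1 q.2) i a).2 (hz i a)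

theorem IsHigh.constrain {φ : UnaryPP R} (hφ : φ.IsHigh) {ι : Type*} [Fintype ι] [DecidableEq ι]
    (c : ι → Fin φ.k) {ψ : ι → UnaryPP R} (hψ : ∀ i, (ψ i).IsHigh) :
    (φ.constrain c ψ).IsHigh := by
  intro N _ _ hN
  rw [eq_top_iff]
  intro x _
  obtain ⟨y, hy⟩ : x ∈ φ.eval N := hφ N hN ▸ AddSubgroup.mem_top x
  exact mem_constrain_eval.2 ⟨y, hy, fun i => hψ i N hN ▸ AddSubgroup.mem_top _⟩

end UnaryPP

theorem exists_witness_mem_eval_of_mem_ulm {R : Type u} [Ring R] {M : Type v} [AddCommGroup M]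
    [Module R M] {x : M} (hx : x ∈ ulm R M) {φ : UnaryPP R} (hφ : φ.IsHigh)
    (F : Finset {ψ : UnaryPP R // ψ.IsHigh}) :
    ∃ y : Fin φ.k → M, (∀ i, ∑ j, φ.A i j • y j = φ.b i • x) ∧
      ∀ ψ ∈ F, ∀ j, y j ∈ ψ.1.eval M := by
  classical
  obtain ⟨y, hy, hyF⟩ := UnaryPP.mem_constrain_eval.1 <|
    hx _ <| hφ.constrain (ι := F × Fin φ.k) Prod.snd fun p => p.1.1.2
  exact ⟨y, hy, fun ψ hψ j => hyF (⟨ψ, hψ⟩, j)⟩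

section LinearMap

variable {R : Type u} [Ring R] {M : Type v} [AddCommGroup M] [Module R M] {N : Type w}
  [AddCommGroup N] [Module R N]

theorem UnaryPP.map_mem_eval (f : M →ₗ[R] N) {φ : UnaryPP R} {x : M} (hx : x ∈ φ.eval M) :
    f x ∈ φ.eval N := by
  obtain ⟨y, hy⟩ := hx
  exact ⟨f ∘ y, fun i => by simpa using congrArg f (hy i)⟩

theorem map_mem_ulm (f : M →ₗ[R] N) {x : M} (hx : x ∈ ulm R M) : f x ∈ ulm R N :=
  fun φ hφ => φ.map_mem_eval f (hx φ hφ)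

end LinearMap

section Ulm

variable {R : Type u} [Ring R] {M : Type v} [AddCommGroup M] [Module R M]

theorem mem_ulmSeq_add_one {α : Ordinal.{w}} {x : M} :
    x ∈ ulmSeq R M (α + 1) ↔ x ∈ ulmSeq R M α ∧ ∀ φ : UnaryPP R, φ.IsHigh →
      ∃ y : Fin φ.k → M, (∀ j, y j ∈ ulmSeq R M α) ∧ ∀ i, ∑ j, φ.A i j • y j = φ.b i • x := by
  simp only [ulmSeq_add_one, Submodule.mem_map, Subtype.exists, Submodule.subtype_apply,
    exists_and_right, exists_eq_right]
  constructor
  · rintro ⟨hx, h⟩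
    refine ⟨hx, fun φ hφ => ?_⟩
    obtain ⟨y, hy⟩ := h φ hφ
    exact ⟨fun j => y j, fun j => (y j).2, fun i => by simpa using congrArg Subtype.val (hy i)⟩
  · rintro ⟨hx, h⟩
    refine ⟨hx, fun φ hφ => ?_⟩
    obtain ⟨y, hyα, hy⟩ := h φ hφ
    exact ⟨fun j => ⟨y j, hyα j⟩, fun i => Subtype.ext (by simpa using hy i)⟩

theorem ulmSeq_one : ulmSeq R M (1 : Ordinal.{w}) = ulm R M := by
  ext x
  rw [← zero_add (1 : Ordinal.{w}), mem_ulmSeq_add_one]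
  simp only [ulmSeq_zero, Submodule.mem_top, implies_true, true_and]
  rfl

theorem map_mem_ulmSeq {N : Type*} [AddCommGroup N] [Module R N] (f : M →ₗ[R] N)
    (α : Ordinal.{w}) {x : M} (hx : x ∈ ulmSeq R M α) : f x ∈ ulmSeq R N α := by
  induction α using Ordinal.limitRecOn generalizing x with
  | zero => simp only [ulmSeq_zero, Submodule.mem_top]
  | add_one α ih =>
    obtain ⟨hxα, hxφ⟩ := mem_ulmSeq_add_one.1 hx
    refine mem_ulmSeq_add_one.2 ⟨ih hxα, fun φ hφ => ?_⟩
    obtain ⟨y, hyα, hy⟩ := hxφ φ hφ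
    exact ⟨f ∘ y, fun j => ih (hyα j), fun i => by simpa using congrArg f (hy i)⟩
  | limit δ hδ ih =>
    simp only [ulmSeq_limit _ _ _ hδ, Submodule.mem_iInf] at hx ⊢
    exact fun β hβ => ih β hβ (hx β hβ)

theorem ulmLength_le_one_of_ulm_le (h : ulm R M ≤ ulmSeq R M ((1 : Ordinal.{v}) + 1)) :
    ulmLength R M ≤ 1 :=
  csInf_le' <| (ulmSeq_antitone R M le_self_add).antisymm <| ulmSeq_one.trans_le h

end Ulm

/-! ### Elementary linear maps -/

namespace moduleLanguage

variable {R : Type u} [Ring R] {α : Type*}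

/-- The term `c 0 • t 0 + (c 1 • t 1 + ⋯ + 0)`. -/
def linearCombination : ∀ {k : ℕ}, (Fin k → R) → (Fin k → (moduleLanguage R).Term α) →
    (moduleLanguage R).Term α
  | 0, _, _ => Language.Constants.term (L := moduleLanguage R) ModuleFunc.zero
  | _ + 1, c, t =>
    Language.Functions.apply₂ (L := moduleLanguage R) ModuleFunc.add
      (Language.Functions.apply₁ (L := moduleLanguage R) (ModuleFunc.smul (c 0)) (t 0))
      (linearCombination (Fin.tail c) (Fin.tail t))

theorem realize_linearCombination {M : Type v} [AddCommGroup M] [Module R M] {k : ℕ}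
    (c : Fin k → R) (t : Fin k → (moduleLanguage R).Term α) (v : α → M) :
    (linearCombination c t).realize v = ∑ j, c j • (t j).realize v := by
  induction k with
  | zero => rfl
  | succ k ih => rw [Fin.sum_univ_succ]; exact congrArg (c 0 • (t 0).realize v + ·) (ih _ _)

variable {M : Type v} [AddCommGroup M] [Module R M] {N : Type w} [AddCommGroup N] [Module R N]

/-- A linear map, as a homomorphism of first-order structures. -/
def homOfLinearMap (f : M →ₗ[R] N) : M →[moduleLanguage R] N where
  toFun := f
  map_fun' := by
    rintro n (_ | _ | _ | r) x
    · exact map_zero f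
    · exact map_neg f _
    · exact map_add f _ _
    · exact map_smul f r _
  map_rel' r := Empty.elim r

/-- An injective linear map, as an embedding of first-order structures. -/
def embeddingOfLinearMap (f : M →ₗ[R] N) (hf : Function.Injective f) :
    M ↪[moduleLanguage R] N where
  toFun := f
  inj' := hf
  map_fun' := (homOfLinearMap f).map_fun'
  map_rel' r := Empty.elim r

/-- A linear equivalence, as an equivalence of first-order structures. -/
def equivOfLinearEquiv (e : M ≃ₗ[R] N) : M ≃[moduleLanguage R] N where
  toEquiv := e.toEquiv
  map_fun' := (homOfLinearMap e.toLinearMap).map_fun'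
  map_rel' r := Empty.elim r

end moduleLanguage

/-- The unary pp formula `φ`, as a first-order formula with one free variable. -/
noncomputable def UnaryPP.toFormula {R : Type u} [Ring R] (φ : UnaryPP R) :
    (moduleLanguage R).Formula Unit :=
  .iExs (Fin φ.k) <| .iInf fun i =>
    (moduleLanguage.linearCombination (φ.A i) fun j => .var (Sum.inr j)).equal
      (moduleLanguage.linearCombination ![φ.b i] fun _ => .var (Sum.inl ()))

theorem UnaryPP.realize_toFormula {R : Type u} [Ring R] {M : Type v} [AddCommGroup M] [Module R M]
    (φ : UnaryPP R) (x : M) : φ.toFormula.Realize (fun _ => x) ↔ x ∈ φ.eval M := by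
  simp [toFormula, moduleLanguage.realize_linearCombination, mem_eval,
    Language.Formula.realize_iExs, Language.Formula.realize_iInf]

/-- A linear map is elementary if it preserves and reflects all first-order formulas. -/
def IsElementaryMap {R : Type u} [Ring R] {M : Type v} [AddCommGroup M] [Module R M] {N : Type w}
    [AddCommGroup N] [Module R N] (f : M →ₗ[R] N) : Prop :=
  ∃ g : M ↪ₑ[moduleLanguage R] N, ⇑g = f

namespace IsElementaryMap

variable {R : Type u} [Ring R] {M : Type*} [AddCommGroup M] [Module R M] {N : Type*}
  [AddCommGroup N] [Module R N] {f : M →ₗ[R] N}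

theorem of_linearEquiv (e : M ≃ₗ[R] N) : IsElementaryMap e.toLinearMap :=
  ⟨(moduleLanguage.equivOfLinearEquiv e).toElementaryEmbedding, rfl⟩

theorem comp {P : Type*} [AddCommGroup P] [Module R P] {g : N →ₗ[R] P} (hg : IsElementaryMap g)
    (hf : IsElementaryMap f) : IsElementaryMap (g ∘ₗ f) := by
  obtain ⟨g', hg'⟩ := hg
  obtain ⟨f', hf'⟩ := hf
  exact ⟨g'.comp f', by ext x; simp [← hg', ← hf']⟩

theorem injective (hf : IsElementaryMap f) : Function.Injective f := by
  obtain ⟨g, hg⟩ := hf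
  exact hg ▸ g.injective

theorem elementarilyEquivalent (hf : IsElementaryMap f) : M ≅[moduleLanguage R] N :=
  let ⟨g, _⟩ := hf
  g.elementarilyEquivalent

theorem isElementary_range (hf : IsElementaryMap f) : (LinearMap.range f).IsElementary := by
  let e := LinearEquiv.ofInjective f hf.injective
  obtain ⟨g, hg⟩ := hf.comp (of_linearEquiv e.symm)
  exact ⟨g, fun x => (congrFun hg x).trans (congrArg Subtype.val (e.apply_symm_apply x))⟩

theorem map_mem_eval_iff (hf : IsElementaryMap f) {φ : UnaryPP R} {x : M} :
    f x ∈ φ.eval N ↔ x ∈ φ.eval M := by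
  obtain ⟨g, hg⟩ := hf
  rw [← hg, ← φ.realize_toFormula, ← φ.realize_toFormula, ← g.map_formula]
  rfl

theorem map_mem_ulm_iff (hf : IsElementaryMap f) {x : M} : f x ∈ ulm R N ↔ x ∈ ulm R M :=
  forall₂_congr fun _ _ => hf.map_mem_eval_iff

end IsElementaryMap

/-! ### Unions of elementary chains -/

theorem realize_comp_iff_of_elementary_directed {L : Language} {ι : Type*} [Preorder ι]
    [IsDirectedOrder ι] {G : ι → Type*} [∀ i, L.Structure (G i)] {N : Type*} [L.Structure N]
    (f : ∀ i j, i ≤ j → G i ↪ₑ[L] G j) (g : ∀ i, G i ↪[L] N)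
    (hgf : ∀ i j h x, g j (f i j h x) = g i x) (hg : ∀ y, ∃ i x, g i x = y) {α : Type*} {n : ℕ}
    (φ : L.BoundedFormula α n) (i : ι) (v : α → G i) (x : Fin n → G i) :
    φ.Realize (g i ∘ v) (g i ∘ x) ↔ φ.Realize v x := by
  induction φ generalizing i with
  | falsum => rfl
  | equal t₁ t₂ =>
    simp only [Language.BoundedFormula.Realize, ← Sum.comp_elim,
      Language.HomClass.realize_term, (g i).injective.eq_iff]
  | rel r ts =>
    simp only [Language.BoundedFormula.Realize, ← Sum.comp_elim, Language.HomClass.realize_term]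
    exact (g i).map_rel r _
  | imp _ _ ih₁ ih₂ => simp only [Language.BoundedFormula.Realize, ih₁, ih₂]
  | all φ ih =>
    refine ⟨fun h a => (ih i v _).1 <| by simpa only [Fin.comp_snoc] using h (g i a), fun h y => ?_⟩
    -- `y` lives at a stage `k ≥ i`, where the formula holds because `f i k` is elementary.
    obtain ⟨j, b, rfl⟩ := hg y
    obtain ⟨k, hik, hjk⟩ := exists_ge_ge i j
    have hk := (ih k _ _).2 <| ((f i k hik).map_boundedFormula φ.all v x).2 h (f j k hjk b)
    rw [Fin.comp_snoc] at hk
    simpa only [Function.comp_def, hgf] using hk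

section DirectLimit

variable {R : Type u} [Ring R] {ι : Type w} [Preorder ι] [IsDirectedOrder ι] [Nonempty ι]
  [DecidableEq ι] {G : ι → Type v} [∀ i, AddCommGroup (G i)] [∀ i, Module R (G i)]
  {f : ∀ i j, i ≤ j → G i →ₗ[R] G j} [DirectedSystem G (f · · ·)]

theorem isElementaryMap_directLimit_of (hf : ∀ i j h, IsElementaryMap (f i j h)) (i : ι) :
    IsElementaryMap (Module.DirectLimit.of R ι G f i) := by
  have of_injective (i) : Function.Injective (Module.DirectLimit.of R ι G f i) := fun _ _ hxy =>
    let ⟨j, hij, h⟩ := Module.DirectLimit.exists_eq_of_of_eq hxy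
    (hf i j hij).injective h
  choose e he using hf
  refine ⟨⟨Module.DirectLimit.of R ι G f i, fun n φ x => ?_⟩, rfl⟩
  have h := realize_comp_iff_of_elementary_directed e
    (fun i => moduleLanguage.embeddingOfLinearMap _ (of_injective i))
    (fun i j h x => (he i j h ▸ Module.DirectLimit.of_f :)) Module.DirectLimit.exists_of φ i x
    default
  rwa [Unique.eq_default (_ ∘ default)] at h

theorem ulmLength_directLimit_le_one (hf : ∀ i j h, IsElementaryMap (f i j h))
    (hulm : ∀ i, ∃ j, ∃ h : i ≤ j, ∀ x ∈ ulm R (G i),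
      f i j h x ∈ ulmSeq R (G j) ((1 : Ordinal.{max v w}) + 1)) :
    ulmLength R (Module.DirectLimit G f) ≤ 1 := by
  refine ulmLength_le_one_of_ulm_le fun x hx => ?_
  obtain ⟨i, x, rfl⟩ := Module.DirectLimit.exists_of x
  obtain ⟨j, hij, hj⟩ := hulm i
  rw [← Module.DirectLimit.of_f (hij := hij)]
  exact map_mem_ulmSeq _ _ (hj x ((isElementaryMap_directLimit_of hf i).map_mem_ulm_iff.1 hx))

end DirectLimit

/-! ### Ultrapowers -/

section Ultrapower

open Filter

theorem germ_sum_smul_coe {R M I k : Type*} [Semiring R] [AddCommMonoid M] [Module R M]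
    [Fintype k] (l : Filter I) (c : k → R) (y : k → I → M) :
    ∑ j, c j • (y j : Germ l M) = ((∑ j, c j • y j : I → M) : Germ l M) :=
  (map_sum (Germ.coeAddHom l) (fun j => c j • y j) Finset.univ).symm

/-- The diagonal map into a reduced power. -/
def germDiagonal (R : Type*) [Semiring R] (M : Type*) [AddCommMonoid M] [Module R M] {I : Type*}
    (l : Filter I) : M →ₗ[R] Germ l M where
  toFun x := (x : Germ l M)
  map_add' _ _ := rfl
  map_smul' _ _ := rfl

variable {R : Type u} [Ring R] {M : Type v} [AddCommGroup M] [Module R M] {I : Type w}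
  (U : Ultrafilter I)

variable (R M) in
/-- The ultrapower as a module of germs is the ultrapower as a first-order structure. -/
def germEquivUltraproduct :
    Germ (U : Filter I) M ≃[moduleLanguage R] (U : Filter I).Product fun _ => M where
  toEquiv := Equiv.refl _
  map_fun' := by
    intro n f x
    obtain ⟨y, rfl⟩ : ∃ y : Fin n → I → M, (fun i => (y i : Germ (U : Filter I) M)) = x :=
      ⟨fun i => (x i).out, funext fun i => (x i).out_eq⟩
    refine Eq.trans ?_ (Language.Ultraproduct.funMap_cast f y).symm
    cases f <;> rfl
  map_rel' r := Empty.elim r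

theorem germ_formula_realize_coe {α : Type*} (φ : (moduleLanguage R).Formula α) (x : α → I → M) :
    φ.Realize (fun i => (x i : Germ (U : Filter I) M)) ↔ ∀ᶠ a in U, φ.Realize fun i => x i a := by
  rw [← Language.Ultraproduct.realize_formula_cast]
  exact (Language.StrongHomClass.realize_formula (germEquivUltraproduct R M U) φ).symm

theorem isElementaryMap_germDiagonal : IsElementaryMap (germDiagonal R M (U : Filter I)) :=
  ⟨⟨germDiagonal R M (U : Filter I), fun _ φ x =>
    (germ_formula_realize_coe U φ fun i _ => x i).trans eventually_const⟩, rfl⟩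

theorem germ_coe_mem_eval_iff {φ : UnaryPP R} {x : I → M} :
    (x : Germ (U : Filter I) M) ∈ φ.eval (Germ (U : Filter I) M) ↔
      ∀ᶠ a in U, x a ∈ φ.eval M := by
  simp only [← UnaryPP.realize_toFormula]
  exact germ_formula_realize_coe U φ.toFormula fun _ => x

end Ultrapower

section HighUltrapower

open Filter

variable (R : Type u) [Ring R] (M : Type v) [AddCommGroup M] [Module R M]

/-- An ultrafilter on the finite sets of high formulas that contains all upward cones. -/
noncomputable def highUltrafilter : Ultrafilter (Finset {ψ : UnaryPP R // ψ.IsHigh}) :=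
  Ultrafilter.of atTop

/-- The ultrapower of `M` along `highUltrafilter R`. -/
abbrev HighUltrapower : Type (max u v) :=
  Germ (highUltrafilter R : Filter (Finset {ψ : UnaryPP R // ψ.IsHigh})) M

variable {R} in
theorem eventually_mem_highUltrafilter (ψ : {ψ : UnaryPP R // ψ.IsHigh}) :
    ∀ᶠ F in (highUltrafilter R : Filter (Finset {ψ : UnaryPP R // ψ.IsHigh})), ψ ∈ F :=
  Ultrafilter.of_le _ <| (eventually_ge_atTop {ψ}).mono fun _ => Finset.singleton_subset_iff.1

/-- The diagonal map of `M` into its ultrapower along `highUltrafilter R`. -/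
noncomputable def highDiagonal : M →ₗ[R] HighUltrapower R M :=
  germDiagonal R M _

variable {R M}

theorem highDiagonal_mem_ulmSeq_two {x : M} (hx : x ∈ ulm R M) :
    highDiagonal R M x ∈ ulmSeq R (HighUltrapower R M) ((1 : Ordinal.{w}) + 1) := by
  rw [mem_ulmSeq_add_one, ulmSeq_one]
  refine ⟨map_mem_ulm _ hx, fun φ hφ => ?_⟩
  choose y hy hyF using exists_witness_mem_eval_of_mem_ulm hx hφ
  refine ⟨fun j => ((y · j) : _ → M), fun j ψ hψ => ?_, fun i => ?_⟩
  · refine (germ_coe_mem_eval_iff _).2 ?_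
    exact (eventually_mem_highUltrafilter ⟨ψ, hψ⟩).mono fun F hF => hyF F _ hF j
  · rw [germ_sum_smul_coe]
    exact congrArg Germ.ofFun (funext fun F => by simpa using hy F i)

end HighUltrapower

section Chain

open CategoryTheory

variable {R : Type u} [Ring R]

instance directedSystem_functor {J : Type*} [Preorder J] (F : J ⥤ ModuleCat.{v} R) :
    DirectedSystem (fun i => F.obj i) fun _ _ h => (F.map (homOfLE h)).hom where
  map_self i x := by simp
  map_map k j i hij hjk x := by
    simp [← ModuleCat.comp_apply, ← Functor.map_comp]

theorem isElementaryMap_ofSequence_map {X : ℕ → ModuleCat.{v} R} {f : ∀ n, X n ⟶ X (n + 1)}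
    (hf : ∀ n, IsElementaryMap (f n).hom) (i j : ℕ) (h : i ≤ j) :
    IsElementaryMap ((Functor.ofSequence f).map (homOfLE h)).hom := by
  induction j, h using Nat.le_induction with
  | base =>
    rw [show homOfLE le_rfl = 𝟙 i from rfl, CategoryTheory.Functor.map_id]
    exact .of_linearEquiv (LinearEquiv.refl R (X i))
  | succ j h ih =>
    rw [← homOfLE_comp h j.le_succ, Functor.map_comp, ModuleCat.hom_comp,
      Functor.ofSequence_map_homOfLE_succ]
    exact (hf j).comp ih

variable (R) (M : Type v) [AddCommGroup M] [Module R M]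

/-- The iterated ultrapowers of `M` along `highUltrafilter R`. They start with a lift of `M` to the
universe of its ultrapowers, so that all of them live in the same universe. -/
noncomputable def iteratedUltrapower : ℕ → ModuleCat.{max u v} R
  | 0 => .of R (ULift.{u} M)
  | n + 1 => .of R (HighUltrapower R (iteratedUltrapower n))

/-- The chain of iterated ultrapowers of `M`, with the diagonal maps as transition maps. -/
noncomputable def ultrapowerChain : ℕ ⥤ ModuleCat.{max u v} R :=
  Functor.ofSequence (X := iteratedUltrapower R M) fun _ => ModuleCat.ofHom (highDiagonal R _)

theorem isElementaryMap_ultrapowerChain_map (i j : ℕ) (h : i ≤ j) :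
    IsElementaryMap ((ultrapowerChain R M).map (homOfLE h)).hom :=
  isElementaryMap_ofSequence_map (fun _ => isElementaryMap_germDiagonal _) i j h

theorem ultrapowerChain_map_mem_ulmSeq_two (n : ℕ) {x : (ultrapowerChain R M).obj n}
    (hx : x ∈ ulm R ((ultrapowerChain R M).obj n)) :
    ((ultrapowerChain R M).map (homOfLE n.le_succ)).hom x ∈
      ulmSeq R ((ultrapowerChain R M).obj (n + 1)) ((1 : Ordinal.{w}) + 1) := by
  have map_succ : ((ultrapowerChain R M).map (homOfLE n.le_succ)).hom = highDiagonal R _ :=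
    congrArg ModuleCat.Hom.hom (Functor.ofSequence_map_homOfLE_succ _ n)
  exact map_succ ▸ highDiagonal_mem_ulmSeq_two hx

end Chain

theorem mainTheorem7 (R : Type u) [Ring R] (M : Type v) [AddCommGroup M] [Module R M] :
    ∃ (N : Type (max u v)) (_ : AddCommGroup N) (_ : Module R N),
      ulmLength R N ≤ 1 ∧
      (M ≅[moduleLanguage R] N) ∧
      ∃ S : Submodule R N, S.IsElementary ∧ Nonempty (M ≃ₗ[R] S) := by
  let G (n : ℕ) := (ultrapowerChain R M).obj n
  let f (i j : ℕ) (h : i ≤ j) : G i →ₗ[R] G j :=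
    ((ultrapowerChain R M).map (CategoryTheory.homOfLE h)).hom
  have hf : ∀ i j h, IsElementaryMap (f i j h) := isElementaryMap_ultrapowerChain_map R M
  let e : M ≃ₗ[R] G 0 := ULift.moduleEquiv.symm
  have hM : IsElementaryMap (Module.DirectLimit.of R ℕ (fun n => G n) f 0 ∘ₗ e.toLinearMap) :=
    (isElementaryMap_directLimit_of hf 0).comp (.of_linearEquiv e)
  have hlength : ulmLength R (Module.DirectLimit (fun n => G n) f) ≤ 1 :=
    ulmLength_directLimit_le_one hf fun n =>
      ⟨n + 1, n.le_succ, fun _ => ultrapowerChain_map_mem_ulmSeq_two R M n⟩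
  exact ⟨Module.DirectLimit (fun n => G n) f, inferInstance, inferInstance, hlength,
    hM.elementarilyEquivalent, _, hM.isElementary_range, ⟨.ofInjective _ hM.injective⟩⟩
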